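/- Call a real $2\times2$ matrix a \emph{unimodular metric} if it is symmetric, positive definite and of determinant $1$. A \emph{deformed metric} is a function $\mathcal M$ of a real variable $w$ (ranging over $\mathbb R$ or over an interval) whose values are unimodular metrics. An $SL(2,\mathbb R)$-valued function $s$ on the same domain acts on deformed metrics by $\mathcal M(w)\mapsto s(w)\,\mathcal M(w)\,s(w)^t$ (the Geroch action). The Cholesky factor of a unimodular metric $S$ is the lower triangular matrix $L$ with positive diagonal entries and $LL^t=S$. A function $f:\mathbb R\to\mathbb C$ is a \emph{Wiener function with constant term} $c$ if $f-c$ is the Fourier transform of a function in $L^1(\mathbb R)$; a matrix valued function is a Wiener function with constant term $C$ if its entries are Wiener functions whose constant terms are the entries of $C$. A set of $SL(2,\mathbb R)$-valued functions is said to act transitively on a set $\Gamma$ of deformed metrics if it is a group under pointwise multiplication, the Geroch action of each of its elements maps $\Gamma$ into itself and defines a group action on $\Gamma$, and any $\mathcal M\in\Gamma$ can be taken to any $\mathcal M'\in\Gamma$ by some element. 1. For all real $a\le b$, the smooth functions $s:[-b,-a]\to SL(2,\mathbb R)$ act transitively on the smooth deformed metrics on $[-b,-a]$. Every such $\mathcal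 M$ has a unique pointwise Cholesky factorization $\mathcal M(w)=s(w)s(w)^t$ ($s(w)$ lower triangular with positive diagonal), and $s$ is smooth and $SL(2,\mathbb R)$-valued. The same holds with $[-b,-a]$ replaced by $\mathbb R$. 2. Sums, scalar multiples and products of Wiener functions are Wiener functions, with constant term the sum, multiple and product, respectively, of the constant terms, and a Wiener function tends to its constant term as $|w|\to\infty$. 3. Let $e_\infty$ be a unimodular metric. (a) The smooth functions $s:\mathbb R\to SL(2,\mathbb R)$ with $s-\mathbf 1=O(1/w)$ as $|w|\to\infty$ act transitively on the smooth deformed metrics $\mathcal M$ on $\mathbb R$ with $\mathcal M-e_\infty=O(1/w)$ as $|w|\to\infty$. (b) The $SL(2,\mathbb R)$-valued Wiener functions $s$ with constant term $\mathbf 1$ act transitively on the deformed metrics $\mathcal M$ on $\mathbb R$ that are Wiener functions with constant term $e_\infty$. This remains true if $s$ and $\mathcal M$ are both required in addition to be $C^\infty$, and also if both are required in addition to be real analytic. (c) Let $L_\infty$ be the (unique) Cholesky factor of $e_\infty$. Every deformed metric $\mathcal M$ that is a Wiener function with constant term $e_\infty$ has a unique pointwise Cholesky factorization $\mathcal M=LL^t$,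 and $L$ is an $SL(2,\mathbb R)$-valued Wiener function with constant term $L_\infty$. Moreover $s=LL_\infty^{-1}$ is an $SL(2,\mathbb R)$-valued Wiener function with constant term $\mathbf 1$, and $\mathcal M(w)=s(w)\,e_\infty\,s(w)^t$. -/

import Mathlib

open Matrix Filter Topology Asymptotics
open scoped ContDiff FourierTransform

/-- Real `2 × 2` matrices. -/
abbrev Mat2 : Type := Matrix (Fin 2) (Fin 2) ℝ

/-- The group `SL(2, ℝ)`. -/
abbrev SL2 : Type := Matrix.SpecialLinearGroup (Fin 2) ℝ

/-- Real, symmetric, positive definite matrices of unit determinant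
(over `ℝ`, `Matrix.PosDef` includes symmetry). -/
def IsUnimodularMetric (S : Mat2) : Prop := S.PosDef ∧ S.det = 1

/-- The Geroch action `M(w) ↦ s(w) M(w) s(w)ᵗ`. -/
def gerochAct {D : Type} (s : D → SL2) (M : D → Mat2) : D → Mat2 :=
  fun w => (s w : Mat2) * M w * (s w : Mat2)ᵀ

/-- `G` is a group under pointwise multiplication which acts, by the Geroch action,
transitively on the set `Γ` of matrix functions. -/
structure ActsTransitively {D : Type} (G : Set (D → SL2)) (Γ : Set (D → Mat2)) : Prop where
  one_mem : (1 : D → SL2) ∈ G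
  mul_mem : ∀ s ∈ G, ∀ t ∈ G, s * t ∈ G
  inv_mem : ∀ s ∈ G, s⁻¹ ∈ G
  act_mem : ∀ s ∈ G, ∀ M ∈ Γ, gerochAct s M ∈ Γ
  one_act : ∀ M ∈ Γ, gerochAct 1 M = M
  mul_act : ∀ s ∈ G, ∀ t ∈ G, ∀ M ∈ Γ, gerochAct (s * t) M = gerochAct s (gerochAct t M)
  transitive : ∀ M ∈ Γ, ∀ M' ∈ Γ, ∃ s ∈ G, gerochAct s M = M'

/-- `L` is the Cholesky factor of `S`: lower triangular with positive diagonal and `L Lᵗ = S`. -/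
structure IsCholesky (L S : Mat2) : Prop where
  lower : L 0 1 = 0
  diag_pos : ∀ i, 0 < L i i
  mul_transpose : L * Lᵀ = S

/-- Every `M ∈ Γ` has a pointwise Cholesky factorization `M = L Lᵗ`, unique among all matrix
functions, and its factor has unit determinant and belongs to the class `𝓛`. -/
def CholeskyFactorsIn {D : Type} (Γ : Set (D → Mat2)) (𝓛 : Set (D → SL2)) : Prop :=
  ∀ M ∈ Γ, ∃ L ∈ 𝓛, (∀ w, IsCholesky (L w : Mat2) (M w)) ∧
    ∀ L' : D → Mat2, (∀ w, IsCholesky (L' w) (M w)) → ∀ w, L' w = (L w : Mat2)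

/-! ### Smooth functions on a segment -/

/-- A function given on the segment `[p, q]` is smooth (one-sidedly at the end points). -/
def SmoothOnSegment {p q : ℝ} (f : Set.Icc p q → ℝ) : Prop :=
  ∃ F : ℝ → ℝ, ContDiffOn ℝ ∞ F (Set.Icc p q) ∧ ∀ w : Set.Icc p q, F w = f w

/-- The Geroch group for the axis segment `a ≤ t ≤ b`: smooth `s : [-b, -a] → SL(2, ℝ)`. -/
def segmentGroup (a b : ℝ) : Set (Set.Icc (-b) (-a) → SL2) :=
  {s | ∀ i j, SmoothOnSegment fun w => (s w : Mat2) i j}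

/-- Smooth deformed metrics `M(w)` on `a ≤ -w ≤ b`. -/
def segmentMetrics (a b : ℝ) : Set (Set.Icc (-b) (-a) → Mat2) :=
  {M | (∀ w, IsUnimodularMetric (M w)) ∧ ∀ i j, SmoothOnSegment fun w => M w i j}

/-! ### Functions on the whole line -/

/-- Entries of class `C^n` on the real line (`n = ∞`: smooth; `n = ω`: real analytic). -/
def IsOfClass (n : WithTop ℕ∞) (A : ℝ → Mat2) : Prop :=
  ∀ i j, ContDiff ℝ n fun w => A w i j

/-- `SL(2, ℝ)` valued functions on the line, of class `C^n`. -/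
def lineGroup (n : WithTop ℕ∞) : Set (ℝ → SL2) :=
  {s | IsOfClass n fun w => (s w : Mat2)}

/-- Deformed metrics on the line, of class `C^n`. -/
def lineMetrics (n : WithTop ℕ∞) : Set (ℝ → Mat2) :=
  {M | (∀ w, IsUnimodularMetric (M w)) ∧ IsOfClass n M}

/-- `A - C` falls off as `1/w` or faster as `|w| → ∞`. -/
def FallsOffTo (A : ℝ → Mat2) (C : Mat2) : Prop :=
  ∀ i j, (fun w => A w i j - C i j) =O[cocompact ℝ] fun w : ℝ => w⁻¹

/-- `SL(2, ℝ)` valued functions `s` such that `s - 1` falls off as `1/w` or faster. -/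
def falloffGroup : Set (ℝ → SL2) :=
  {s | FallsOffTo (fun w => (s w : Mat2)) 1}

/-- Deformed metrics `M` such that `M - e` falls off as `1/w` or faster. -/
def falloffMetrics (e : Mat2) : Set (ℝ → Mat2) :=
  {M | (∀ w, IsUnimodularMetric (M w)) ∧ FallsOffTo M e}

/-- `f` is a Wiener function with constant term `c`: the sum of `c` and the Fourier transform of
an absolutely integrable function. -/
def IsWiener (f : ℝ → ℂ) (c : ℂ) : Prop :=
  ∃ g : ℝ → ℂ, MeasureTheory.Integrable g ∧ ∀ w, f w = c + 𝓕 g w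

/-- The entries of `A` are Wiener functions whose constant terms are the entries of `C`. -/
def IsWienerMatrix (A : ℝ → Mat2) (C : Mat2) : Prop :=
  ∀ i j, IsWiener (fun w => (A w i j : ℂ)) (C i j : ℂ)

/-- `SL(2, ℝ)` valued Wiener functions with constant term `C`. -/
def wienerFunctions (C : SL2) : Set (ℝ → SL2) :=
  {s | IsWienerMatrix (fun w => (s w : Mat2)) (C : Mat2)}

/-- The asymptotic-flatness-preserving Geroch group in the Wiener sense: constant term `1`. -/
def wienerGroup : Set (ℝ → SL2) := wienerFunctions 1

/-- Wiener function deformed metrics with constant term `e`. -/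
def wienerMetrics (e : Mat2) : Set (ℝ → Mat2) :=
  {M | (∀ w, IsUnimodularMetric (M w)) ∧ IsWienerMatrix M e}

/-! A unimodular metric with first column `(a, b)` has the explicit Cholesky factor with rows `(√a,
0)` and `(b/√a, 1/√a)`. Hence a class of functions with constant terms that contains the constants
and is closed under sums, products and `f ↦ 1/√f` for positive `f` with positive constant term
(`IsCoefficientClass`) also contains the entries of Cholesky factors. If `M = L Lᵗ` and `M' = L'
L'ᵗ`, then `s = L' L⁻¹` takes `M` to `M'`; when both metrics have constant term `e`, both factors
have the Cholesky factor of `e` as constant term, so that of `s` is `1`.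

Only Wiener functions make the last closure property hard (`IsWiener.inv_sqrt`). A positive Wiener
function with positive constant term lies between constants `0 < m ≤ K`, so `u = 1 - f/K` satisfies
`|u| ≤ 1 - m/K < 1` and `1/√f` is a multiple of the power series of `(1 - z)^(-1/2)` at `u`.
Convergence in Wiener norm requires that the spectral radius of `u` not exceed its supremum, a
quantitative Wiener–Lévy statement (`IsWiener.exists_normLE_pow`). It follows by splitting `u` into
a constant plus a Schwartz function, whose powers are estimated through two derivatives, and a
remainder of small norm. -/

open MeasureTheory

/-! ### The Wiener algebra as a Banach algebra. -/

/-- `f` is a Wiener function with constant term `c`, whose norm in the Wiener algebra (the modulus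
of the constant term plus the `L¹` norm) is at most `K`. -/
def WienerNormLE (f : ℝ → ℂ) (c : ℂ) (K : ℝ) : Prop :=
  ∃ g : ℝ → ℂ, Integrable g ∧ (∀ w, f w = c + 𝓕 g w) ∧ ‖c‖ + ∫ x, ‖g x‖ ≤ K

theorem WienerNormLE.isWiener {f : ℝ → ℂ} {c : ℂ} {K : ℝ} (h : WienerNormLE f c K) :
    IsWiener f c :=
  let ⟨g, hg, hf, _⟩ := h
  ⟨g, hg, hf⟩

theorem IsWiener.exists_normLE {f : ℝ → ℂ} {c : ℂ} (h : IsWiener f c) :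
    ∃ K, WienerNormLE f c K :=
  let ⟨g, hg, hf⟩ := h
  ⟨_, g, hg, hf, le_rfl⟩

theorem WienerNormLE.mono {f : ℝ → ℂ} {c : ℂ} {K K' : ℝ} (h : WienerNormLE f c K)
    (hK : K ≤ K') : WienerNormLE f c K' :=
  let ⟨g, hg, hf, hn⟩ := h
  ⟨g, hg, hf, hn.trans hK⟩

theorem WienerNormLE.nonneg {f : ℝ → ℂ} {c : ℂ} {K : ℝ} (h : WienerNormLE f c K) : 0 ≤ K :=
  let ⟨_, _, _, hn⟩ := h
  le_trans (by positivity) hn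

theorem WienerNormLE.const (c : ℂ) : WienerNormLE (fun _ => c) c ‖c‖ :=
  ⟨fun _ => 0, integrable_zero _ _ _, fun w => by simp [Real.fourier_eq], by simp⟩

theorem fourier_add_apply {g h : ℝ → ℂ} (hg : Integrable g) (hh : Integrable h) (w : ℝ) :
    𝓕 (fun x => g x + h x) w = 𝓕 g w + 𝓕 h w := by
  simp only [Real.fourier_eq, smul_add]
  exact integral_add ((Real.fourierIntegral_convergent_iff w).2 hg)
    ((Real.fourierIntegral_convergent_iff w).2 hh)

theorem fourier_const_mul_apply (k : ℂ) (g : ℝ → ℂ) (w : ℝ) :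
    𝓕 (fun x => k * g x) w = k * 𝓕 g w := by
  simp only [Real.fourier_eq, Circle.smul_def, smul_eq_mul, mul_left_comm _ k]
  exact integral_const_mul k _

theorem norm_fourier_le (g : ℝ → ℂ) (w : ℝ) : ‖𝓕 g w‖ ≤ ∫ x, ‖g x‖ := by
  rw [Real.fourier_eq]
  refine (norm_integral_le_integral_norm _).trans_eq ?_
  simp

theorem WienerNormLE.norm_le {f : ℝ → ℂ} {c : ℂ} {K : ℝ} (h : WienerNormLE f c K) (w : ℝ) :
    ‖f w‖ ≤ K := by
  obtain ⟨g, hg, hf, hn⟩ := h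
  rw [hf]
  exact (norm_add_le _ _).trans ((add_le_add_right (norm_fourier_le g w) _).trans hn)

theorem WienerNormLE.add {f₁ f₂ : ℝ → ℂ} {c₁ c₂ : ℂ} {K₁ K₂ : ℝ}
    (h₁ : WienerNormLE f₁ c₁ K₁) (h₂ : WienerNormLE f₂ c₂ K₂) :
    WienerNormLE (fun w => f₁ w + f₂ w) (c₁ + c₂) (K₁ + K₂) := by
  obtain ⟨g₁, hg₁, hf₁, hn₁⟩ := h₁
  obtain ⟨g₂, hg₂, hf₂, hn₂⟩ := h₂
  refine ⟨fun x => g₁ x + g₂ x, hg₁.add hg₂, fun w => ?_, ?_⟩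
  · simp only [fourier_add_apply hg₁ hg₂, hf₁, hf₂]; ring
  · have : ∫ x, ‖g₁ x + g₂ x‖ ≤ (∫ x, ‖g₁ x‖) + ∫ x, ‖g₂ x‖ := by
      rw [← integral_add hg₁.norm hg₂.norm]
      exact integral_mono (hg₁.add hg₂).norm (hg₁.norm.add hg₂.norm) fun x => norm_add_le _ _
    linarith [norm_add_le c₁ c₂]

theorem WienerNormLE.const_mul {f : ℝ → ℂ} {c : ℂ} {K : ℝ} (h : WienerNormLE f c K) (k : ℂ) :
    WienerNormLE (fun w => k * f w) (k * c) (‖k‖ * K) := by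
  obtain ⟨g, hg, hf, hn⟩ := h
  refine ⟨fun x => k * g x, hg.const_mul k, fun w => ?_, ?_⟩
  · simp only [fourier_const_mul_apply, hf]; ring
  · simp only [norm_mul, integral_const_mul]
    rw [← mul_add]
    gcongr

/-- Pointwise `|g ⋆ h| ≤ |g| ⋆ |h|`, and the integral of a convolution is the product of the
integrals. -/
theorem integral_norm_convolution_le {g h : ℝ → ℂ} (hg : Integrable g) (hh : Integrable h) :
    ∫ x, ‖(convolution g h (ContinuousLinearMap.mul ℂ ℂ) volume) x‖ ≤
      (∫ x, ‖g x‖) * ∫ x, ‖h x‖ := by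
  have key := integral_convolution (μ := volume) (ν := volume) (ContinuousLinearMap.mul ℝ ℝ)
    hg.norm hh.norm
  simp only [ContinuousLinearMap.mul_apply'] at key
  rw [← key]
  refine integral_mono (hg.integrable_convolution _ hh).norm
    (hg.norm.integrable_convolution _ hh.norm) fun x => ?_
  refine (norm_integral_le_integral_norm _).trans_eq ?_
  simp [convolution]

theorem WienerNormLE.mul {f₁ f₂ : ℝ → ℂ} {c₁ c₂ : ℂ} {K₁ K₂ : ℝ}
    (h₁ : WienerNormLE f₁ c₁ K₁) (h₂ : WienerNormLE f₂ c₂ K₂) :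
    WienerNormLE (fun w => f₁ w * f₂ w) (c₁ * c₂) (K₁ * K₂) := by
  have hK₁ := h₁.nonneg
  obtain ⟨g₁, hg₁, hf₁, hn₁⟩ := h₁
  obtain ⟨g₂, hg₂, hf₂, hn₂⟩ := h₂
  set g₃ := convolution g₁ g₂ (ContinuousLinearMap.mul ℂ ℂ) volume with hg₃d
  have hg₃ : Integrable g₃ := hg₁.integrable_convolution _ hg₂
  have i₁ : Integrable fun x => c₁ * g₂ x := hg₂.const_mul c₁
  have i₂ : Integrable fun x => c₂ * g₁ x := hg₁.const_mul c₂
  have i₃ : Integrable fun x => c₁ * g₂ x + c₂ * g₁ x := i₁.add i₂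
  refine ⟨fun x => (c₁ * g₂ x + c₂ * g₁ x) + g₃ x, i₃.add hg₃, fun w => ?_, ?_⟩
  · change f₁ w * f₂ w = _
    rw [fourier_add_apply i₃ hg₃, fourier_add_apply i₁ i₂, fourier_const_mul_apply,
      fourier_const_mul_apply, hg₃d, Real.fourier_mul_convolution_eq hg₁ hg₂, hf₁, hf₂]
    ring
  · have j : Integrable fun x => ‖c₁‖ * ‖g₂ x‖ + ‖c₂‖ * ‖g₁ x‖ :=
      (hg₂.norm.const_mul _).add (hg₁.norm.const_mul _)
    have e : ∫ x, ‖(c₁ * g₂ x + c₂ * g₁ x) + g₃ x‖ ≤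
        ‖c₁‖ * (∫ x, ‖g₂ x‖) + ‖c₂‖ * (∫ x, ‖g₁ x‖) + ∫ x, ‖g₃ x‖ := by
      rw [← integral_const_mul, ← integral_const_mul,
        ← integral_add (hg₂.norm.const_mul _) (hg₁.norm.const_mul _),
        ← integral_add j hg₃.norm]
      refine integral_mono (i₃.add hg₃).norm
        (j.add hg₃.norm) fun x => ?_
      refine (norm_add_le _ _).trans (add_le_add_left ?_ _)
      exact (norm_add_le _ _).trans_eq (by simp)
    have e₃ := integral_norm_convolution_le hg₁ hg₂
    rw [norm_mul]
    calc _ ≤ (‖c₁‖ + ∫ x, ‖g₁ x‖) * (‖c₂‖ + ∫ x, ‖g₂ x‖) := by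
          rw [hg₃d] at e ⊢; linarith
      _ ≤ K₁ * K₂ := mul_le_mul hn₁ hn₂ (by positivity) hK₁

theorem WienerNormLE.pow {f : ℝ → ℂ} {c : ℂ} {K : ℝ} (h : WienerNormLE f c K) (n : ℕ) :
    WienerNormLE (fun w => f w ^ n) (c ^ n) (K ^ n) := by
  induction n with
  | zero => simpa using WienerNormLE.const 1
  | succ n ih => simpa only [pow_succ] using ih.mul h

theorem WienerNormLE.sum {ι : Type*} (s : Finset ι) {f : ι → ℝ → ℂ} {c : ι → ℂ} {K : ι → ℝ}
    (h : ∀ i ∈ s, WienerNormLE (f i) (c i) (K i)) :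
    WienerNormLE (fun w => ∑ i ∈ s, f i w) (∑ i ∈ s, c i) (∑ i ∈ s, K i) := by
  classical
  induction s using Finset.induction_on with
  | empty => simpa using WienerNormLE.const 0
  | insert a s ha ih =>
    simp only [Finset.sum_insert ha]
    exact (h a (by simp)).add (ih fun i hi => h i (by simp [hi]))

/-- Completeness of the algebra: summability of the `L¹` norms makes the series of densities
converge almost everywhere to an integrable function, and the Fourier integral may be taken
termwise. -/
theorem WienerNormLE.tsum {f : ℕ → ℝ → ℂ} {c : ℕ → ℂ} {K : ℕ → ℝ}
    (h : ∀ n, WienerNormLE (f n) (c n) (K n)) (hK : Summable K) :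
    IsWiener (fun w => ∑' n, f n w) (∑' n, c n) := by
  choose g hg hf hn using h
  have hK0 : ∀ n, ∫ x, ‖g n x‖ ≤ K n := fun n => by linarith [hn n, norm_nonneg (c n)]
  have hs : Summable fun n => ∫ x, ‖g n x‖ :=
    hK.of_nonneg_of_le (fun n => integral_nonneg fun x => norm_nonneg _) hK0
  have hc : Summable c := hK.of_norm_bounded fun n => by
    have : 0 ≤ ∫ x, ‖g n x‖ := integral_nonneg fun x => norm_nonneg _
    linarith [hn n]
  have hfin : ∑' n, ∫⁻ x, ‖g n x‖ₑ ≠ ⊤ := by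
    have (n : ℕ) : ∫⁻ x, ‖g n x‖ₑ = ENNReal.ofReal (∫ x, ‖g n x‖) :=
      (ofReal_integral_norm_eq_lintegral_enorm (hg n)).symm
    simp only [this]
    exact hs.tsum_ofReal_ne_top
  have hmeas : ∀ n, AEMeasurable (fun x => ‖g n x‖ₑ) := fun n => (hg n).1.enorm
  have hlt : ∫⁻ x, ∑' n, ‖g n x‖ₑ < ⊤ := by
    rw [lintegral_tsum hmeas]; exact hfin.lt_top
  have hae : ∀ᵐ x, Summable fun n => ‖g n x‖ := by
    filter_upwards [ae_lt_top' (AEMeasurable.tsum hmeas) hlt.ne] with x hx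
    have := ENNReal.summable_toReal hx.ne
    simpa using this
  have hint : Integrable fun x => ∑' n, g n x := by
    refine ⟨?_, ?_⟩
    · refine aestronglyMeasurable_of_tendsto_ae atTop
        (f := fun N x => ∑ n ∈ Finset.range N, g n x) (fun N => ?_) ?_
      · exact Finset.aestronglyMeasurable_fun_sum _ fun n _ => (hg n).1
      · filter_upwards [hae] with x hx
        exact hx.of_norm.hasSum.tendsto_sum_nat
    · refine lt_of_le_of_lt (lintegral_mono_ae ?_) hlt
      filter_upwards [hae] with x hx
      exact enorm_tsum_le_tsum_enorm
  refine ⟨_, hint, fun w => ?_⟩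
  have hF := hasSum_integral_of_summable_integral_norm (μ := volume)
    (F := fun n x => Real.fourierChar (-inner ℝ x w) • g n x)
    (fun n => (Real.fourierIntegral_convergent_iff w).2 (hg n)) (by simpa using hs)
  have e : (∫ x, ∑' n, Real.fourierChar (-inner ℝ x w) • g n x) =
      𝓕 (fun x => ∑' n, g n x) w := by
    rw [Real.fourier_eq]
    refine integral_congr_ae ?_
    filter_upwards [hae] with x hx
    simp only [Circle.smul_def]
    exact hx.of_norm.tsum_const_smul _
  rw [e] at hF
  simp only [← Real.fourier_eq] at hF
  simp only [hf]
  rw [hc.tsum_add hF.summable, hF.tsum_eq]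

/-! ### Riemann–Lebesgue lemma and continuity. -/

theorem IsWiener.tendsto {f : ℝ → ℂ} {c : ℂ} (h : IsWiener f c) :
    Tendsto f (cocompact ℝ) (𝓝 c) := by
  obtain ⟨g, hg, hf⟩ := h
  have := (Real.zero_at_infty_fourier g).const_add c
  rw [add_zero] at this
  exact this.congr fun w => (hf w).symm

theorem IsWiener.continuous {f : ℝ → ℂ} {c : ℂ} (h : IsWiener f c) : Continuous f := by
  obtain ⟨g, hg, hf⟩ := h
  rw [funext hf]
  exact continuous_const.add (VectorFourier.fourierIntegral_continuous
    Real.continuous_fourierChar (L := innerₗ ℝ) (by fun_prop) hg)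

theorem IsWiener.norm_const_le {f : ℝ → ℂ} {c : ℂ} {ρ : ℝ} (h : IsWiener f c)
    (hf : ∀ w, ‖f w‖ ≤ ρ) : ‖c‖ ≤ ρ :=
  le_of_tendsto h.tendsto.norm (Eventually.of_forall hf)

/-! ### Growth of powers in the Wiener norm. -/

/-- Two derivatives multiply the transform by a factor of modulus `(2πx)²`, which dominates `x²`. -/
theorem norm_fourier_le_inv_one_add_sq {ψ ψ' ψ'' : ℝ → ℂ} (h₁ : ∀ x, HasDerivAt ψ (ψ' x) x)
    (h₂ : ∀ x, HasDerivAt ψ' (ψ'' x) x) (i₀ : Integrable ψ) (i₁ : Integrable ψ')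
    (i₂ : Integrable ψ'') (x : ℝ) :
    ‖𝓕 ψ x‖ ≤ ((∫ y, ‖ψ y‖) + ∫ y, ‖ψ'' y‖) * (1 + x ^ 2)⁻¹ := by
  have d₁ : deriv ψ = ψ' := funext fun y => (h₁ y).deriv
  have d₂ : deriv ψ' = ψ'' := funext fun y => (h₂ y).deriv
  have e₁ := congrFun (Real.fourier_deriv i₀ (fun y => (h₁ y).differentiableAt)
    (by rwa [d₁])) x
  have e₂ := congrFun (Real.fourier_deriv i₁ (fun y => (h₂ y).differentiableAt)
    (by rwa [d₂])) x
  rw [d₁] at e₁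
  rw [d₂, e₁] at e₂
  have e₃ : ‖𝓕 ψ'' x‖ = (2 * Real.pi * x) ^ 2 * ‖𝓕 ψ x‖ := by
    rw [e₂]
    simp only [smul_eq_mul, norm_mul, Complex.norm_I, Complex.norm_real, Complex.norm_ofNat,
      Real.norm_eq_abs, abs_of_pos Real.pi_pos]
    rw [mul_pow, ← sq_abs x]
    ring
  have b₀ := norm_fourier_le ψ x
  have b₂ := norm_fourier_le ψ'' x
  rw [e₃] at b₂
  rw [← div_eq_mul_inv, le_div_iff₀ (by positivity)]
  have hx : x ^ 2 ≤ (2 * Real.pi * x) ^ 2 := by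
    rw [mul_pow]
    exact le_mul_of_one_le_left (sq_nonneg x) (by nlinarith [Real.pi_gt_three])
  nlinarith [mul_le_mul_of_nonneg_right hx (norm_nonneg (𝓕 ψ x))]

/-- The decay `1/(1 + x²)`, of integral `π`, makes the inverse transform of `ψ` integrable; this is
the density sought. -/
theorem WienerNormLE.of_hasDerivAt {ψ ψ' ψ'' : ℝ → ℂ} (h₁ : ∀ x, HasDerivAt ψ (ψ' x) x)
    (h₂ : ∀ x, HasDerivAt ψ' (ψ'' x) x) (i₀ : Integrable ψ) (i₁ : Integrable ψ')
    (i₂ : Integrable ψ'') :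
    WienerNormLE ψ 0 (((∫ y, ‖ψ y‖) + ∫ y, ‖ψ'' y‖) * Real.pi) := by
  have hb := norm_fourier_le_inv_one_add_sq h₁ h₂ i₀ i₁ i₂
  have hcont : Continuous ψ := continuous_iff_continuousAt.2 fun x => (h₁ x).continuousAt
  have hFcont : Continuous (𝓕 ψ) := VectorFourier.fourierIntegral_continuous
    Real.continuous_fourierChar (L := innerₗ ℝ) (by fun_prop) i₀
  have hdom := integrable_inv_one_add_sq.const_mul ((∫ y, ‖ψ y‖) + ∫ y, ‖ψ'' y‖)
  have hF : Integrable (𝓕 ψ) := hdom.mono' hFcont.aestronglyMeasurable (Eventually.of_forall hb)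
  have hinv : 𝓕⁻ ψ = fun x => 𝓕 ψ (-x) := funext fun x => Real.fourierInv_eq_fourier_neg ψ x
  refine ⟨𝓕⁻ ψ, hinv ▸ hF.comp_neg, fun w => ?_, ?_⟩
  · rw [hcont.fourier_fourierInv_eq i₀ hF, zero_add]
  · rw [norm_zero, zero_add, hinv, integral_neg_eq_self (fun x => ‖𝓕 ψ x‖),
      ← integral_univ_inv_one_add_sq, ← integral_const_mul]
    exact integral_mono hF.norm hdom hb

/-- The factor `R` on the left avoids the exponent `n - 1`. -/
theorem mul_norm_pow_sub_pow_le {a b : ℂ} {R : ℝ} (ha : ‖a‖ ≤ R) (hb : ‖b‖ ≤ R) (n : ℕ) :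
    R * ‖a ^ n - b ^ n‖ ≤ n * R ^ n * ‖a - b‖ := by
  have hR : 0 ≤ R := (norm_nonneg a).trans ha
  induction n with
  | zero => simp
  | succ n ih =>
    have e : a ^ (n + 1) - b ^ (n + 1) = a * (a ^ n - b ^ n) + (a - b) * b ^ n := by ring
    have e₁ : ‖a ^ (n + 1) - b ^ (n + 1)‖ ≤ R * ‖a ^ n - b ^ n‖ + ‖a - b‖ * R ^ n := by
      rw [e]
      refine (norm_add_le _ _).trans ?_
      rw [norm_mul, norm_mul, norm_pow]
      gcongr
    calc R * ‖a ^ (n + 1) - b ^ (n + 1)‖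
        ≤ R * (n * R ^ n * ‖a - b‖ + ‖a - b‖ * R ^ n) := by
          gcongr; exact e₁.trans (by gcongr)
      _ = _ := by push_cast; ring

/-- With `v = c + φ`, differentiating `v ^ n` twice costs only a factor of order `n²` besides powers
of `R`, so the growth exceeds `R ^ n` at most polynomially. -/
theorem WienerNormLE.const_add_schwartz_pow (φ : SchwartzMap ℝ ℂ) {c : ℂ} {R : ℝ} (hR : 0 < R)
    (hc : ‖c‖ ≤ R) (hv : ∀ w, ‖c + φ w‖ ≤ R) :
    ∃ C, 0 ≤ C ∧
      ∀ n : ℕ, WienerNormLE (fun w => (c + φ w) ^ n) (c ^ n) (C * ((n : ℝ) + 1) ^ 2 * R ^ n) := by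
  set φ₁ := SchwartzMap.derivCLM ℂ ℂ φ with hφ₁
  set φ₂ := SchwartzMap.derivCLM ℂ ℂ φ₁ with hφ₂
  have d₀ : ∀ x, HasDerivAt (fun x => c + φ x) (φ₁ x) x := fun x => by
    rw [hφ₁, SchwartzMap.derivCLM_apply]; exact (φ.hasDerivAt x).const_add c
  have d₁ : ∀ x, HasDerivAt φ₁ (φ₂ x) x := fun x => by
    rw [hφ₂, SchwartzMap.derivCLM_apply]; exact φ₁.hasDerivAt x
  have vcont : Continuous fun x => c + φ x := continuous_const.add φ.continuous
  have i₁sq : Integrable fun x => ‖φ₁ x‖ ^ 2 := by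
    simpa using (φ₁.memLp 2 volume).integrable_norm_pow two_ne_zero
  set A := ∫ x, ‖φ x‖
  set B := ∫ x, (‖φ₁ x‖ ^ 2 + R * ‖φ₂ x‖)
  have hA : 0 ≤ A := integral_nonneg fun x => norm_nonneg _
  have hB : 0 ≤ B := integral_nonneg fun x => by positivity
  have iB : Integrable fun x => ‖φ₁ x‖ ^ 2 + R * ‖φ₂ x‖ :=
    i₁sq.add (φ₂.integrable.norm.const_mul R)
  refine ⟨1 + (A / R + B / R ^ 2) * Real.pi, by positivity, fun n => ?_⟩
  set ψ : ℝ → ℂ := fun x => (c + φ x) ^ n - c ^ n with hψ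
  set ψ' : ℝ → ℂ := fun x => n * (c + φ x) ^ (n - 1) * φ₁ x with hψ'
  set ψ'' : ℝ → ℂ := fun x => n * ((n - 1 : ℕ) * (c + φ x) ^ (n - 1 - 1) * φ₁ x) * φ₁ x +
    n * (c + φ x) ^ (n - 1) * φ₂ x with hψ''
  have D₁ : ∀ x, HasDerivAt ψ (ψ' x) x := fun x => ((d₀ x).pow n).sub_const _
  have D₂ : ∀ x, HasDerivAt ψ' (ψ'' x) x := fun x =>
    (((d₀ x).pow (n - 1)).const_mul (n : ℂ)).mul (d₁ x)
  have b₀ : ∀ x, ‖ψ x‖ ≤ (n * R ^ n / R) * ‖φ x‖ := fun x => by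
    have := mul_norm_pow_sub_pow_le (hv x) hc n
    rw [add_sub_cancel_left] at this
    rw [div_mul_eq_mul_div, le_div_iff₀ hR, mul_comm]
    exact this
  -- The prefactors `n` and `n - 1` vanish exactly where the natural subtraction in the exponents
  -- truncates.
  have p₁ : n * R ^ (n - 1) = n * R ^ n / R := by
    rcases n with _ | n
    · simp
    · rw [Nat.add_sub_cancel, pow_succ]; field_simp
  have p₂ : n * ((n - 1 : ℕ) * R ^ (n - 1 - 1)) ≤ n ^ 2 * R ^ n / R ^ 2 := by
    rcases n with _ | _ | n
    · simp
    · simp; positivity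
    · have : ((n + 1 + 1 - 1 : ℕ) : ℝ) ≤ ((n + 1 + 1 : ℕ) : ℝ) := by
        exact_mod_cast Nat.sub_le _ _
      calc _ ≤ ((n + 1 + 1 : ℕ) : ℝ) * (((n + 1 + 1 : ℕ) : ℝ) * R ^ n) := by
            rw [Nat.add_sub_cancel, Nat.add_sub_cancel] at *
            gcongr
        _ = _ := by rw [pow_succ R (n + 1), pow_succ R n]; field_simp
  have b₁ : ∀ x, ‖ψ' x‖ ≤ (n * R ^ n / R) * ‖φ₁ x‖ := fun x => by
    rw [hψ', ← p₁]
    simp only [norm_mul, norm_pow, Complex.norm_natCast]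
    gcongr
    exact hv x
  have hn : (n : ℝ) ≤ (n : ℝ) ^ 2 := by exact_mod_cast Nat.le_self_pow two_ne_zero n
  have b₂ : ∀ x, ‖ψ'' x‖ ≤ (n ^ 2 * R ^ n / R ^ 2) * (‖φ₁ x‖ ^ 2 + R * ‖φ₂ x‖) := fun x => by
    have t₁ : ‖n * ((n - 1 : ℕ) * (c + φ x) ^ (n - 1 - 1) * φ₁ x) * φ₁ x‖ ≤
        (n ^ 2 * R ^ n / R ^ 2) * ‖φ₁ x‖ ^ 2 := by
      simp only [norm_mul, norm_pow, Complex.norm_natCast]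
      calc _ = (n * ((n - 1 : ℕ) * ‖c + φ x‖ ^ (n - 1 - 1))) * ‖φ₁ x‖ ^ 2 := by ring
        _ ≤ (n * ((n - 1 : ℕ) * R ^ (n - 1 - 1))) * ‖φ₁ x‖ ^ 2 := by
          gcongr; exact hv x
        _ ≤ _ := by gcongr
    have t₂ : ‖n * (c + φ x) ^ (n - 1) * φ₂ x‖ ≤ (n ^ 2 * R ^ n / R ^ 2) * (R * ‖φ₂ x‖) := by
      simp only [norm_mul, norm_pow, Complex.norm_natCast]
      calc _ ≤ n * R ^ (n - 1) * ‖φ₂ x‖ := by gcongr; exact hv x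
        _ = n * R ^ n / R * ‖φ₂ x‖ := by rw [p₁]
        _ ≤ n ^ 2 * R ^ n / R * ‖φ₂ x‖ := by gcongr
        _ = _ := by field_simp
    exact (norm_add_le _ _).trans ((add_le_add t₁ t₂).trans_eq (by ring))
  have c' : Continuous ψ' := by
    rw [hψ']; exact (continuous_const.mul (vcont.pow _)).mul φ₁.continuous
  have c'' : Continuous ψ'' := by
    rw [hψ'']
    exact ((continuous_const.mul ((continuous_const.mul (vcont.pow _)).mul φ₁.continuous)).mul
      φ₁.continuous).add ((continuous_const.mul (vcont.pow _)).mul φ₂.continuous)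
  have j₀ := φ.integrable (μ := volume).norm.const_mul (n * R ^ n / R)
  have j₂ := iB.const_mul (n ^ 2 * R ^ n / R ^ 2)
  have i₀ : Integrable ψ := j₀.mono'
    ((vcont.pow n).sub continuous_const).aestronglyMeasurable (Eventually.of_forall b₀)
  have i₁ : Integrable ψ' := (φ₁.integrable.norm.const_mul (n * R ^ n / R)).mono'
    c'.aestronglyMeasurable (Eventually.of_forall b₁)
  have i₂ : Integrable ψ'' := j₂.mono' c''.aestronglyMeasurable (Eventually.of_forall b₂)
  have k₀ : ∫ x, ‖ψ x‖ ≤ n * R ^ n / R * A := by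
    rw [← integral_const_mul]; exact integral_mono i₀.norm j₀ b₀
  have k₂ : ∫ x, ‖ψ'' x‖ ≤ n ^ 2 * R ^ n / R ^ 2 * B := by
    rw [← integral_const_mul]; exact integral_mono i₂.norm j₂ b₂
  have key := (WienerNormLE.const (c ^ n)).add (WienerNormLE.of_hasDerivAt D₁ D₂ i₀ i₁ i₂)
  simp only [hψ, add_sub_cancel, add_zero] at key
  refine key.mono ?_
  have q₁ : (1 : ℝ) ≤ ((n : ℝ) + 1) ^ 2 := one_le_pow₀ (by linarith [n.cast_nonneg (α := ℝ)])
  have q₂ : (n : ℝ) ≤ ((n : ℝ) + 1) ^ 2 := by nlinarith [n.cast_nonneg (α := ℝ)]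
  have q₃ : (n : ℝ) ^ 2 ≤ ((n : ℝ) + 1) ^ 2 := by gcongr; linarith
  calc _ ≤ 1 * R ^ n + (n * R ^ n / R * A + n ^ 2 * R ^ n / R ^ 2 * B) * Real.pi := by
        rw [norm_pow, one_mul]; gcongr
    _ ≤ ((n : ℝ) + 1) ^ 2 * R ^ n + (((n : ℝ) + 1) ^ 2 * R ^ n / R * A +
        ((n : ℝ) + 1) ^ 2 * R ^ n / R ^ 2 * B) * Real.pi := by gcongr
    _ = _ := by ring

/-- Spectral radius bound: approximating the density in `L¹` by a smooth compactly supported one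
leaves a remainder `r` of norm at most `ε`, and the binomial theorem combines the powers of the two
parts. -/
theorem IsWiener.exists_normLE_pow {f : ℝ → ℂ} {c : ℂ} {ρ q : ℝ} (h : IsWiener f c)
    (hf : ∀ w, ‖f w‖ ≤ ρ) (hq : ρ < q) :
    ∃ C, 0 ≤ C ∧
      ∀ n : ℕ, WienerNormLE (fun w => f w ^ n) (c ^ n) (C * ((n : ℝ) + 1) ^ 2 * q ^ n) := by
  have hρ : 0 ≤ ρ := (norm_nonneg _).trans (hf 0)
  have hc := h.norm_const_le hf
  obtain ⟨g, hg, hfg⟩ := h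
  -- One `ε` is lost in the supremum of the Schwartz part, another in the norm of `r`: `q = (ρ + ε)
  -- + ε`.
  set ε := (q - ρ) / 2 with hε
  have hε0 : 0 < ε := by rw [hε]; linarith
  obtain ⟨k, hk, hk', hgk⟩ := (memLp_one_iff_integrable.2 hg).exist_eLpNorm_sub_le
    ENNReal.one_ne_top le_rfl hε0
  have ik : Integrable k := hk'.continuous.integrable_of_hasCompactSupport hk
  have igk : Integrable (g - k) := hg.sub ik
  set φ : SchwartzMap ℝ ℂ := 𝓕 (hk.toSchwartzMap hk') with hφ
  have hφk : ∀ w, φ w = 𝓕 k w := fun w => by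
    rw [hφ, SchwartzMap.fourier_coe]; rfl
  set r : ℝ → ℂ := 𝓕 (g - k) with hr
  have hr' : WienerNormLE r 0 ε := by
    refine ⟨g - k, igk, fun w => (zero_add _).symm, ?_⟩
    rw [norm_zero, zero_add, ← ENNReal.ofReal_le_ofReal_iff hε0.le,
      ofReal_integral_norm_eq_lintegral_enorm igk, ← eLpNorm_one_eq_lintegral_enorm]
    exact hgk
  have hsum : ∀ w, f w = (c + φ w) + r w := fun w => by
    have : 𝓕 g w = 𝓕 k w + r w := by
      rw [hr, ← fourier_add_apply ik igk]; simp
    rw [hfg, this, hφk]; ring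
  set R := ρ + ε with hR
  have hv : ∀ w, ‖c + φ w‖ ≤ R := fun w => by
    have : c + φ w = f w - r w := by rw [hsum]; ring
    rw [this, hR]
    exact (norm_sub_le (f w) (r w)).trans (add_le_add (hf w) (hr'.norm_le w))
  obtain ⟨C, hC, hpow⟩ := WienerNormLE.const_add_schwartz_pow φ (R := R) (by positivity)
    (hc.trans (by linarith)) hv
  refine ⟨C, hC, fun n => ?_⟩
  have key := WienerNormLE.sum (Finset.range (n + 1)) fun m _ =>
    ((hpow m).mul (hr'.pow (n - m))).mul (WienerNormLE.const ((n.choose m : ℕ) : ℂ))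
  simp only [← add_pow, ← hsum, add_zero, Complex.norm_natCast] at key
  refine key.mono ?_
  have hqR : q = R + ε := by rw [hR, hε]; ring
  rw [hqR, add_pow R ε n, Finset.mul_sum]
  refine Finset.sum_le_sum fun m hm => ?_
  have hm' : (m : ℝ) ≤ n := by exact_mod_cast Finset.mem_range_succ_iff.1 hm
  calc _ ≤ C * ((n : ℝ) + 1) ^ 2 * R ^ m * ε ^ (n - m) * (n.choose m : ℝ) := by gcongr
    _ = _ := by ring

/-! ### Power series and inverse square roots of Wiener functions. -/

/-- A Wiener function whose values stay in a compact disc inside the disc of convergence of a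
power series can be substituted into the series. -/
theorem IsWiener.comp_hasFPowerSeriesOnBall {F : ℂ → ℂ} {p : FormalMultilinearSeries ℂ ℂ ℂ}
    {r : ENNReal} (hF : HasFPowerSeriesOnBall F p 0 r) {f : ℝ → ℂ} {c : ℂ} {ρ : ℝ}
    (h : IsWiener f c) (hf : ∀ w, ‖f w‖ ≤ ρ) (hρ : ENNReal.ofReal ρ < r) :
    IsWiener (fun w => F (f w)) (F c) := by
  have hρ0 : 0 ≤ ρ := (norm_nonneg _).trans (hf 0)
  obtain ⟨t, ht, htr⟩ := ENNReal.lt_iff_exists_nnreal_btwn.1 hρ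
  have hρt : ρ < t := by
    rw [← ENNReal.ofReal_coe_nnreal] at ht
    exact (ENNReal.ofReal_lt_ofReal_iff_of_nonneg hρ0).1 ht
  obtain ⟨q, hρq, hqt⟩ := exists_between hρt
  have hq0 : 0 ≤ q := hρ0.trans hρq.le
  have ht0 : (0 : ℝ) < t := hρ0.trans_lt hρt
  obtain ⟨C, hC, hpow⟩ := h.exists_normLE_pow hf hρq
  obtain ⟨C', hC', hp⟩ := p.norm_mul_pow_le_of_lt_radius (htr.trans_le hF.r_le)
  have hval : ∀ z : ℂ, ‖z‖ ≤ ρ → F z = ∑' n, p.coeff n * z ^ n := fun z hz => by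
    have hz' : z ∈ Metric.eball (0 : ℂ) r := by
      rw [Metric.mem_eball, edist_zero_right, ← ofReal_norm]
      exact (ENNReal.ofReal_le_ofReal hz).trans_lt hρ
    have := (hF.hasSum hz').tsum_eq
    simp only [FormalMultilinearSeries.apply_eq_pow_smul_coeff, zero_add, smul_eq_mul] at this
    rw [← this]
    exact tsum_congr fun n => mul_comm _ _
  have hfF : (fun w => F (f w)) = fun w => ∑' n, p.coeff n * f w ^ n :=
    funext fun w => hval _ (hf w)
  rw [hfF, hval c (h.norm_const_le hf)]
  refine WienerNormLE.tsum (fun n => (hpow n).const_mul (p.coeff n)) ?_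
  have hqt1 : ‖q / (t : ℝ)‖ < 1 := by
    rw [Real.norm_of_nonneg (by positivity), div_lt_one ht0]; exact hqt
  -- The majorant is `C' C (n² + 2n + 1) (q/t)ⁿ`, with `ρ < q < t` and `t` below the radius of
  -- convergence.
  have s := ((summable_pow_mul_geometric_of_norm_lt_one 2 hqt1).add
    (((summable_pow_mul_geometric_of_norm_lt_one 1 hqt1).mul_left 2).add
      (summable_geometric_of_norm_lt_one hqt1))).mul_left (C' * C)
  refine s.of_nonneg_of_le (fun n => by positivity) fun n => ?_
  have hb : ‖p.coeff n‖ ≤ C' / (t : ℝ) ^ n := by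
    rw [le_div_iff₀ (by positivity), ← p.norm_apply_eq_norm_coef]
    exact hp n
  calc _ ≤ C' / (t : ℝ) ^ n * (C * ((n : ℝ) + 1) ^ 2 * q ^ n) := by gcongr
    _ = _ := by rw [div_pow]; field_simp; ring

theorem IsWiener.mul {f g : ℝ → ℂ} {c d : ℂ} (hf : IsWiener f c) (hg : IsWiener g d) :
    IsWiener (fun w => f w * g w) (c * d) :=
  let ⟨_, h₁⟩ := hf.exists_normLE
  let ⟨_, h₂⟩ := hg.exists_normLE
  (h₁.mul h₂).isWiener

theorem IsWiener.add {f g : ℝ → ℂ} {c d : ℂ} (hf : IsWiener f c) (hg : IsWiener g d) :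
    IsWiener (fun w => f w + g w) (c + d) :=
  let ⟨_, h₁⟩ := hf.exists_normLE
  let ⟨_, h₂⟩ := hg.exists_normLE
  (h₁.add h₂).isWiener

theorem IsWiener.const_mul {f : ℝ → ℂ} {c : ℂ} (hf : IsWiener f c) (k : ℂ) :
    IsWiener (fun w => k * f w) (k * c) :=
  let ⟨_, h⟩ := hf.exists_normLE
  (h.const_mul k).isWiener

theorem isWiener_const (c : ℂ) : IsWiener (fun _ => c) c :=
  (WienerNormLE.const c).isWiener

theorem exists_pos_forall_le_of_tendsto_cocompact {f : ℝ → ℝ} {c : ℝ} (hcont : Continuous f)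
    (hf : ∀ w, 0 < f w) (hc : 0 < c) (hlim : Tendsto f (cocompact ℝ) (𝓝 c)) :
    ∃ m, 0 < m ∧ ∀ w, m ≤ f w := by
  have ev : ∀ᶠ w in cocompact ℝ, c / 2 < f w := hlim.eventually (lt_mem_nhds (half_lt_self hc))
  obtain ⟨K, hK, hKf⟩ := mem_cocompact.1 ev
  rcases K.eq_empty_or_nonempty with rfl | hne
  · exact ⟨c / 2, half_pos hc, fun w => le_of_lt (hKf (by simp))⟩
  · obtain ⟨x, -, hx⟩ := hK.exists_isMinOn hne hcont.continuousOn
    refine ⟨min (c / 2) (f x), lt_min (half_pos hc) (hf x), fun w => ?_⟩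
    by_cases hw : w ∈ K
    · exact (min_le_right _ _).trans (hx hw)
    · exact (min_le_left _ _).trans (hKf hw).le

theorem IsWiener.inv_sqrt {f : ℝ → ℝ} {c : ℝ} (h : IsWiener (fun w => (f w : ℂ)) c)
    (hf : ∀ w, 0 < f w) (hc : 0 < c) :
    IsWiener (fun w => (((√(f w))⁻¹ : ℝ) : ℂ)) (((√c)⁻¹ : ℝ) : ℂ) := by
  have hcont : Continuous f := by
    simpa [Function.comp_def] using Complex.continuous_re.comp h.continuous
  have hlim : Tendsto f (cocompact ℝ) (𝓝 c) := by
    simpa [Function.comp_def] using (Complex.continuous_re.tendsto (c : ℂ)).comp h.tendsto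
  obtain ⟨m, hm, hmf⟩ := exists_pos_forall_le_of_tendsto_cocompact hcont hf hc hlim
  obtain ⟨K, hK⟩ := h.exists_normLE
  have hfK : ∀ w, f w ≤ K := fun w => by
    have := hK.norm_le w
    rw [Complex.norm_real, Real.norm_eq_abs] at this
    exact (le_abs_self _).trans this
  have hK0 : 0 < K := (hf 0).trans_le (hfK 0)
  have hu : IsWiener (fun w => ((1 - f w / K : ℝ) : ℂ)) ((1 - c / K : ℝ) : ℂ) := by
    have := (isWiener_const 1).add (h.const_mul (-(K : ℂ)⁻¹))
    push_cast
    convert this using 2 <;> ring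
  have hub : ∀ w, ‖((1 - f w / K : ℝ) : ℂ)‖ ≤ 1 - m / K := fun w => by
    have h₁ : m / K ≤ f w / K := by gcongr; exact hmf w
    have h₂ : f w / K ≤ 1 := (div_le_one hK0).2 (hfK w)
    rw [Complex.norm_real, Real.norm_of_nonneg (by linarith)]
    linarith
  have hρ : ENNReal.ofReal (1 - m / K) < 1 := by
    rw [← ENNReal.ofReal_one, ENNReal.ofReal_lt_ofReal_iff one_pos]
    linarith [div_pos hm hK0]
  have key := hu.comp_hasFPowerSeriesOnBall
    (Complex.one_div_one_sub_cpow_hasFPowerSeriesOnBall_zero (1 / 2)) hub hρ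
  have val : ∀ x : ℝ, 0 < x → 1 / (1 - ((1 - x / K : ℝ) : ℂ)) ^ (1 / 2 : ℂ) =
      ((√K * (√x)⁻¹ : ℝ) : ℂ) := fun x hx => by
    have e₁ : (1 : ℂ) - ((1 - x / K : ℝ) : ℂ) = ((x / K : ℝ) : ℂ) := by push_cast; ring
    have e₂ : (1 / 2 : ℂ) = ((1 / 2 : ℝ) : ℂ) := by push_cast; ring
    rw [e₁, e₂, ← Complex.ofReal_cpow (by positivity), ← Real.sqrt_eq_rpow,
      Real.sqrt_div hx.le]
    push_cast
    rw [one_div, inv_div, div_eq_mul_inv]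
  simp only [val _ (hf _), val c hc] at key
  have := key.const_mul (((√K)⁻¹ : ℝ) : ℂ)
  simpa only [← Complex.ofReal_mul, inv_mul_cancel_left₀ (Real.sqrt_pos.2 hK0).ne'] using this

/-! ### Cholesky factors of unimodular metrics -/

theorem IsUnimodularMetric.symm {S : Mat2} (h : IsUnimodularMetric S) : S 0 1 = S 1 0 := by
  simpa using (h.1.isHermitian.apply 0 1).symm

theorem IsUnimodularMetric.pos {S : Mat2} (h : IsUnimodularMetric S) : 0 < S 0 0 :=
  h.1.diag_pos

theorem IsUnimodularMetric.act {S : Mat2} (h : IsUnimodularMetric S) (A : SL2) :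
    IsUnimodularMetric ((A : Mat2) * S * (A : Mat2)ᵀ) := by
  refine ⟨?_, by simp [h.2]⟩
  rw [← conjTranspose_eq_transpose_of_trivial]
  refine h.1.mul_mul_conjTranspose_same ?_
  exact Matrix.vecMul_injective_of_isUnit ((Matrix.isUnit_iff_isUnit_det _).2 (by simp))

theorem isUnimodularMetric_one : IsUnimodularMetric 1 :=
  ⟨Matrix.PosDef.one, Matrix.det_one⟩

theorem IsCholesky.unique {L L' S : Mat2} (h : IsCholesky L S) (h' : IsCholesky L' S) :
    L = L' := by
  have e := h.mul_transpose.trans h'.mul_transpose.symm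
  have e₀₀ := congrFun (congrFun e 0) 0
  have e₁₀ := congrFun (congrFun e 1) 0
  have e₁₁ := congrFun (congrFun e 1) 1
  simp only [Matrix.mul_apply, Fin.sum_univ_two, Matrix.transpose_apply, h.lower, h'.lower,
    mul_zero, add_zero] at e₀₀ e₁₀ e₁₁
  have p₀ := h.diag_pos 0
  have q₀ : L 0 0 = L' 0 0 :=
    (mul_self_inj p₀.le (h'.diag_pos 0).le).1 e₀₀
  have q₁ : L 1 0 = L' 1 0 := mul_right_cancel₀ p₀.ne' (by rw [e₁₀, q₀])
  have q₂ : L 1 1 = L' 1 1 :=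
    (mul_self_inj (h.diag_pos 1).le (h'.diag_pos 1).le).1 (by rw [q₁] at e₁₁; linarith)
  ext i j
  fin_cases i <;> fin_cases j
  exacts [q₀, h.lower.trans h'.lower.symm, q₁, q₂]

/-- The lower triangular unimodular matrix whose Gram matrix has first column `(a, b)`. -/
noncomputable def choleskyFactor (a b : ℝ) (ha : 0 < a) : SL2 :=
  ⟨!![√a, 0; b * (√a)⁻¹, (√a)⁻¹], by
    rw [Matrix.det_fin_two_of, mul_inv_cancel₀ (Real.sqrt_pos.2 ha).ne', zero_mul, sub_zero]⟩

theorem IsUnimodularMetric.isCholesky {S : Mat2} (h : IsUnimodularMetric S) :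
    IsCholesky (choleskyFactor (S 0 0) (S 1 0) h.pos : Mat2) S := by
  have hs := Real.sqrt_pos.2 h.pos
  have hs2 := Real.mul_self_sqrt h.pos.le
  have hd : S 0 0 * S 1 1 - S 1 0 * S 1 0 = 1 := by
    have := h.2
    rwa [Matrix.det_fin_two, h.symm] at this
  refine ⟨by simp [choleskyFactor], fun i => ?_, ?_⟩
  · fin_cases i <;> simp [choleskyFactor, h.pos]
  · ext i j
    fin_cases i <;> fin_cases j <;>
      simp only [choleskyFactor, Matrix.mul_apply, Fin.sum_univ_two, Matrix.transpose_apply,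
        Fin.zero_eta, Fin.mk_one, Matrix.of_apply, Matrix.cons_val_zero, Matrix.cons_val_one,
        mul_zero, zero_mul, add_zero]
    · exact hs2
    · rw [h.symm]; field_simp
    · field_simp
    · have : S 1 1 = (1 + S 1 0 * S 1 0) / (√(S 0 0) * √(S 0 0)) := by
        rw [hs2, eq_div_iff h.pos.ne']; linarith
      rw [this]; field_simp; ring

/-- Source of transitivity: the quotient of two Cholesky factors carries one metric to the other. -/
theorem mul_inv_act_mul_transpose (A B : SL2) :
    ((A * B⁻¹ : SL2) : Mat2) * ((B : Mat2) * (B : Mat2)ᵀ) * ((A * B⁻¹ : SL2) : Mat2)ᵀ =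
      (A : Mat2) * (A : Mat2)ᵀ := by
  have h : ((A * B⁻¹ : SL2) : Mat2) * (B : Mat2) = A := by
    rw [← Matrix.SpecialLinearGroup.coe_mul, inv_mul_cancel_right]
  rw [← Matrix.mul_assoc, h, Matrix.mul_assoc, ← Matrix.transpose_mul, h]

/-! ### Classes of coefficient functions -/

/-- A class of real functions, each with a distinguished constant term, which contains the
constants and is closed under sums, products and inverse square roots of positive functions. -/
structure IsCoefficientClass {D : Type} (P : (D → ℝ) → ℝ → Prop) : Prop where
  const : ∀ c, P (fun _ => c) c
  add : ∀ {f g c d}, P f c → P g d → P (fun w => f w + g w) (c + d)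
  mul : ∀ {f g c d}, P f c → P g d → P (fun w => f w * g w) (c * d)
  inv_sqrt : ∀ {f c}, P f c → (∀ w, 0 < f w) → 0 < c → P (fun w => (√(f w))⁻¹) (√c)⁻¹

/-- `SL(2, ℝ)` valued functions with entries in the class `P`, with constant term `C`. -/
def classFunctions {D : Type} (P : (D → ℝ) → ℝ → Prop) (C : SL2) : Set (D → SL2) :=
  {s | ∀ i j, P (fun w => (s w : Mat2) i j) ((C : Mat2) i j)}

/-- Deformed metrics with entries in the class `P`, with constant term `e`. -/
def classMetrics {D : Type} (P : (D → ℝ) → ℝ → Prop) (e : Mat2) : Set (D → Mat2) :=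
  {M | (∀ w, IsUnimodularMetric (M w)) ∧ ∀ i j, P (fun w => M w i j) (e i j)}

namespace IsCoefficientClass

variable {D : Type} {P Q : (D → ℝ) → ℝ → Prop}

theorem neg (hP : IsCoefficientClass P) {f : D → ℝ} {c : ℝ} (hf : P f c) :
    P (fun w => -f w) (-c) := by
  simpa using hP.mul (hP.const (-1)) hf

/-- Since `√f = f · (√f)⁻¹`, the inverse square root is the only non-algebraic closure property
required. -/
theorem sqrt (hP : IsCoefficientClass P) {f : D → ℝ} {c : ℝ} (hf : P f c) (h : ∀ w, 0 < f w)
    (hc : 0 < c) : P (fun w => √(f w)) (√c) := by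
  have key := hP.mul hf (hP.inv_sqrt hf h hc)
  have e : ∀ x : ℝ, x * (√x)⁻¹ = √x := fun x => by rw [← div_eq_mul_inv, Real.div_sqrt]
  simpa only [e] using key

theorem and (hP : IsCoefficientClass P) (hQ : IsCoefficientClass Q) :
    IsCoefficientClass fun f c => P f c ∧ Q f c where
  const c := ⟨hP.const c, hQ.const c⟩
  add hf hg := ⟨hP.add hf.1 hg.1, hQ.add hf.2 hg.2⟩
  mul hf hg := ⟨hP.mul hf.1 hg.1, hQ.mul hf.2 hg.2⟩
  inv_sqrt hf h hc := ⟨hP.inv_sqrt hf.1 h hc, hQ.inv_sqrt hf.2 h hc⟩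

theorem matrix_mul (hP : IsCoefficientClass P) {A B : D → Mat2} {C E : Mat2}
    (hA : ∀ i j, P (fun w => A w i j) (C i j)) (hB : ∀ i j, P (fun w => B w i j) (E i j))
    (i j : Fin 2) : P (fun w => (A w * B w) i j) ((C * E) i j) := by
  simp only [Matrix.mul_apply, Fin.sum_univ_two]
  exact hP.add (hP.mul (hA i 0) (hB 0 j)) (hP.mul (hA i 1) (hB 1 j))

theorem mul_mem (hP : IsCoefficientClass P) {s t : D → SL2} {C E : SL2}
    (hs : s ∈ classFunctions P C) (ht : t ∈ classFunctions P E) :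
    s * t ∈ classFunctions P (C * E) := fun i j => by
  simpa only [Pi.mul_apply, Matrix.SpecialLinearGroup.coe_mul] using hP.matrix_mul hs ht i j

/-- In determinant one the inverse is the adjugate, so no division occurs. -/
theorem inv_mem (hP : IsCoefficientClass P) {s : D → SL2} {C : SL2}
    (hs : s ∈ classFunctions P C) : s⁻¹ ∈ classFunctions P C⁻¹ := fun i j => by
  simp only [Pi.inv_apply, Matrix.SpecialLinearGroup.coe_inv, Matrix.adjugate_fin_two]
  fin_cases i <;> fin_cases j
  exacts [hs 1 1, hP.neg (hs 0 1), hP.neg (hs 1 0), hs 0 0]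

theorem const_mem (hP : IsCoefficientClass P) (C : SL2) :
    (fun _ => C) ∈ classFunctions P C := fun _ _ => hP.const _

theorem choleskyFactor_mem (hP : IsCoefficientClass P) {M : D → Mat2} {e : Mat2}
    (hM : M ∈ classMetrics P e) (he : IsUnimodularMetric e) :
    (fun w => choleskyFactor (M w 0 0) (M w 1 0) (hM.1 w).pos) ∈
      classFunctions P (choleskyFactor (e 0 0) (e 1 0) he.pos) := fun i j => by
  have h := hP.inv_sqrt (hM.2 0 0) (fun w => (hM.1 w).pos) he.pos
  fin_cases i <;> fin_cases j
  exacts [hP.sqrt (hM.2 0 0) (fun w => (hM.1 w).pos) he.pos, hP.const 0, hP.mul (hM.2 1 0) h, h]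

theorem mem_of_isCholesky (hP : IsCoefficientClass P) {M : D → Mat2} {e : Mat2}
    (hM : M ∈ classMetrics P e) (he : IsUnimodularMetric e) {L : D → SL2} {C : SL2}
    (hL : ∀ w, IsCholesky (L w : Mat2) (M w)) (hC : IsCholesky (C : Mat2) e) :
    L ∈ classFunctions P C := by
  have h₁ : L = fun w => choleskyFactor (M w 0 0) (M w 1 0) (hM.1 w).pos :=
    funext fun w => Subtype.ext ((hL w).unique (hM.1 w).isCholesky)
  have h₂ : C = choleskyFactor (e 0 0) (e 1 0) he.pos :=
    Subtype.ext (hC.unique he.isCholesky)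
  rw [h₁, h₂]
  exact hP.choleskyFactor_mem hM he

theorem choleskyFactorsIn (hP : IsCoefficientClass P) {e : Mat2} (he : IsUnimodularMetric e)
    {C : SL2} (hC : IsCholesky (C : Mat2) e) :
    CholeskyFactorsIn (classMetrics P e) (classFunctions P C) := fun M hM =>
  ⟨fun w => choleskyFactor (M w 0 0) (M w 1 0) (hM.1 w).pos,
    hP.mem_of_isCholesky hM he (fun w => (hM.1 w).isCholesky) hC,
    fun w => (hM.1 w).isCholesky, fun _ hL' w => (hL' w).unique (hM.1 w).isCholesky⟩

theorem actsTransitively (hP : IsCoefficientClass P) {e : Mat2} (he : IsUnimodularMetric e) :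
    ActsTransitively (classFunctions P 1) (classMetrics P e) where
  one_mem := hP.const_mem 1
  mul_mem s hs t ht := by simpa using hP.mul_mem hs ht
  inv_mem s hs := by simpa using hP.inv_mem hs
  act_mem s hs M hM := by
    refine ⟨fun w => (hM.1 w).act (s w), fun i j => ?_⟩
    have := hP.matrix_mul (hP.matrix_mul hs hM.2) (B := fun w => (s w : Mat2)ᵀ)
      (E := ((1 : SL2) : Mat2)ᵀ) (fun i j => hs j i) i j
    simpa [gerochAct] using this
  one_act M _ := by ext1 w; simp [gerochAct]
  mul_act s _ t _ M _ := by
    ext1 w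
    simp [gerochAct, Matrix.mul_assoc, Matrix.transpose_mul]
  transitive M hM M' hM' := by
    obtain ⟨L, hL, hLM, -⟩ := hP.choleskyFactorsIn he he.isCholesky M hM
    obtain ⟨L', hL', hLM', -⟩ := hP.choleskyFactorsIn he he.isCholesky M' hM'
    refine ⟨L' * L⁻¹, by simpa using hP.mul_mem hL' (hP.inv_mem hL), funext fun w => ?_⟩
    rw [gerochAct, ← (hLM w).mul_transpose, ← (hLM' w).mul_transpose]
    exact mul_inv_act_mul_transpose (L' w) (L w)

/-- The conjunction of two coefficient classes is again one, so a single group element satisfies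
both conditions. -/
theorem inter_actsTransitively (hP : IsCoefficientClass P) (hQ : IsCoefficientClass Q)
    {e : Mat2} (he : IsUnimodularMetric e) :
    ActsTransitively (classFunctions P 1 ∩ classFunctions Q 1)
      (classMetrics P e ∩ classMetrics Q e) := by
  convert (hP.and hQ).actsTransitively he using 1
  · ext s
    simp only [classFunctions, Set.mem_inter_iff, Set.mem_ofPred_eq, forall_and]
  · ext M
    simp only [classMetrics, Set.mem_inter_iff, Set.mem_ofPred_eq, forall_and]
    tauto

end IsCoefficientClass

/-! ### The concrete classes: smooth, analytic, `1/w` falloff, Wiener. -/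

theorem isCoefficientClass_smoothOnSegment (p q : ℝ) :
    IsCoefficientClass fun (f : Set.Icc p q → ℝ) (_ : ℝ) => SmoothOnSegment f where
  const c := ⟨fun _ => c, contDiffOn_const, fun _ => rfl⟩
  add := fun ⟨F, hF, hf⟩ ⟨G, hG, hg⟩ =>
    ⟨fun w => F w + G w, hF.add hG, fun w => by simp only [hf, hg]⟩
  mul := fun ⟨F, hF, hf⟩ ⟨G, hG, hg⟩ =>
    ⟨fun w => F w * G w, hF.mul hG, fun w => by simp only [hf, hg]⟩
  inv_sqrt := fun ⟨F, hF, hf⟩ h _ => by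
    have hpos : ∀ w ∈ Set.Icc p q, 0 < F w := fun w hw => by
      have := h ⟨w, hw⟩
      rwa [← hf] at this
    exact ⟨fun w => (√(F w))⁻¹, (hF.sqrt fun w hw => (hpos w hw).ne').inv
      fun w hw => (Real.sqrt_pos.2 (hpos w hw)).ne', fun w => by simp only [hf]⟩

theorem isCoefficientClass_contDiff (n : WithTop ℕ∞) :
    IsCoefficientClass fun (f : ℝ → ℝ) (_ : ℝ) => ContDiff ℝ n f where
  const _ := contDiff_const
  add hf hg := hf.add hg
  mul hf hg := hf.mul hg
  inv_sqrt hf h _ := (hf.sqrt fun w => (h w).ne').inv fun w => (Real.sqrt_pos.2 (h w)).ne'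

theorem tendsto_inv_cocompact_real : Tendsto (fun w : ℝ => w⁻¹) (cocompact ℝ) (𝓝 0) :=
  tendsto_inv₀_cobounded.mono_left (Metric.cobounded_eq_cocompact (α := ℝ)).ge

theorem tendsto_of_sub_isBigO_inv {f : ℝ → ℝ} {c : ℝ}
    (hf : (fun w => f w - c) =O[cocompact ℝ] fun w : ℝ => w⁻¹) :
    Tendsto f (cocompact ℝ) (𝓝 c) :=
  tendsto_sub_nhds_zero_iff.1 (hf.trans_tendsto tendsto_inv_cocompact_real)

theorem isCoefficientClass_falloff :
    IsCoefficientClass fun (f : ℝ → ℝ) (c : ℝ) =>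
      (fun w => f w - c) =O[cocompact ℝ] fun w : ℝ => w⁻¹ where
  const c := by simpa using isBigO_zero (E' := ℝ) (fun w : ℝ => w⁻¹) (cocompact ℝ)
  add hf hg := (hf.add hg).congr_left fun w => by ring
  mul {f g c d} hf hg := by
    have h₁ := hf.mul ((tendsto_of_sub_isBigO_inv hg).isBigO_one ℝ)
    simp only [mul_one] at h₁
    -- `fg - cd = (f - c) g + c (g - d)`, with `g` bounded near infinity.
    exact (h₁.add (hg.const_mul_left c)).congr_left fun w => by ring
  inv_sqrt {f c} hf _ hc := by
    have hd : DifferentiableAt ℝ (fun x : ℝ => (√x)⁻¹) c :=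
      (differentiableAt_id.sqrt hc.ne').inv (Real.sqrt_pos.2 hc).ne'
    -- Differentiability of `x ↦ 1/√x` at `c > 0` bounds its increment by `O(f - c)`.
    exact (hd.isBigO_sub.comp_tendsto (tendsto_of_sub_isBigO_inv hf)).trans hf

theorem isCoefficientClass_wiener :
    IsCoefficientClass fun (f : ℝ → ℝ) (c : ℝ) => IsWiener (fun w => (f w : ℂ)) (c : ℂ) where
  const c := isWiener_const c
  add hf hg := by simpa only [Complex.ofReal_add] using IsWiener.add hf hg
  mul hf hg := by simpa only [Complex.ofReal_mul] using IsWiener.mul hf hg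
  inv_sqrt hf h hc := IsWiener.inv_sqrt hf h hc

/-! ### The main theorem. -/

theorem mainTheorem7 :
    -- smooth deformed metrics on a segment, and on the whole line
    (∀ a b : ℝ, a ≤ b →
      ActsTransitively (segmentGroup a b) (segmentMetrics a b) ∧
      CholeskyFactorsIn (segmentMetrics a b) (segmentGroup a b)) ∧
    (ActsTransitively (lineGroup ∞) (lineMetrics ∞) ∧
      CholeskyFactorsIn (lineMetrics ∞) (lineGroup ∞)) ∧
    -- Wiener functions form an algebra and tend to their constant terms
    (∀ (f g : ℝ → ℂ) (c d : ℂ), IsWiener f c → IsWiener g d →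
      IsWiener (fun w => f w + g w) (c + d) ∧
      (∀ k : ℂ, IsWiener (fun w => k * f w) (k * c)) ∧
      IsWiener (fun w => f w * g w) (c * d) ∧
      Tendsto f (cocompact ℝ) (𝓝 c)) ∧
    -- asymptotically flat deformed metrics with a common asymptotic value
    (∀ e : Mat2, IsUnimodularMetric e →
      -- `1/w` falloff
      ActsTransitively (lineGroup ∞ ∩ falloffGroup) (lineMetrics ∞ ∩ falloffMetrics e) ∧
      -- Wiener functions; smooth Wiener functions; real analytic Wiener functions
      ActsTransitively wienerGroup (wienerMetrics e) ∧
      ActsTransitively (lineGroup ∞ ∩ wienerGroup) (lineMetrics ∞ ∩ wienerMetrics e) ∧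
      ActsTransitively (lineGroup ω ∩ wienerGroup) (lineMetrics ω ∩ wienerMetrics e) ∧
      -- the Cholesky factor of a Wiener deformed metric is a Wiener function whose constant
      -- term is the Cholesky factor of the asymptotic value
      ∃ C : SL2, IsCholesky (C : Mat2) e ∧
        (∀ C' : Mat2, IsCholesky C' e → C' = (C : Mat2)) ∧
        CholeskyFactorsIn (wienerMetrics e) (wienerFunctions C) ∧
        ∀ M ∈ wienerMetrics e, ∀ L : ℝ → SL2, (∀ w, IsCholesky (L w : Mat2) (M w)) →
          (fun w => L w * C⁻¹) ∈ wienerGroup ∧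
          M = gerochAct (fun w => L w * C⁻¹) (fun _ => e)) := by
  refine ⟨fun a b _ => ?_, ?_, fun f g c d hf hg => ⟨hf.add hg, hf.const_mul, hf.mul hg,
    hf.tendsto⟩, fun e he => ⟨?_, ?_, ?_, ?_, ?_⟩⟩
  · have hP := isCoefficientClass_smoothOnSegment (-b) (-a)
    -- The smooth class ignores its constant term, so the identity serves as a dummy asymptotic
    -- metric.
    exact ⟨hP.actsTransitively isUnimodularMetric_one,
      hP.choleskyFactorsIn isUnimodularMetric_one isUnimodularMetric_one.isCholesky⟩
  · have hP := isCoefficientClass_contDiff ∞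
    exact ⟨hP.actsTransitively isUnimodularMetric_one,
      hP.choleskyFactorsIn isUnimodularMetric_one isUnimodularMetric_one.isCholesky⟩
  · exact (isCoefficientClass_contDiff ∞).inter_actsTransitively isCoefficientClass_falloff he
  · exact isCoefficientClass_wiener.actsTransitively he
  · exact (isCoefficientClass_contDiff ∞).inter_actsTransitively isCoefficientClass_wiener he
  · exact (isCoefficientClass_contDiff ω).inter_actsTransitively isCoefficientClass_wiener he
  · have hW := isCoefficientClass_wiener
    obtain ⟨C, hC⟩ : ∃ C : SL2, IsCholesky (C : Mat2) e := ⟨_, he.isCholesky⟩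
    refine ⟨C, hC, fun C' hC' => hC'.unique hC, hW.choleskyFactorsIn he hC,
      fun M hM L hL => ⟨?_, funext fun w => ?_⟩⟩
    · have := hW.mul_mem (hW.mem_of_isCholesky hM he hL hC) (hW.inv_mem (hW.const_mem C))
      rwa [mul_inv_cancel] at this
    · have := mul_inv_act_mul_transpose (L w) C
      rw [hC.mul_transpose, (hL w).mul_transpose] at this
      exact this.symm
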